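/- Let $n\ge 1$, let $\lambda$ be a partition with at most $n$ nonzero parts, and let $x_1,\dots,x_n$ be commuting invertible indeterminates (or arbitrary invertible elements of a commutative ring). An $(n-1,1)$-symplectic tableau of shape $\lambda$ is a filling of the Young diagram of $\lambda$ with entries from $1<\overline 1<2<\overline 2<\cdots<n-1<\overline{n-1}<n$ which increases weakly across rows and strictly down columns, and in which every entry of the $i$-th row is $\ge i$. The odd symplectic character is $$\mathrm{sp}^{(n-1,1)}_\lambda(x_1,\dots,x_{n-1}\,|\,x_n)=\sum_T x_n^{\alpha_n(T)}\prod_{i=1}^{n-1}x_i^{\alpha_i(T)-\alpha_{\overline i}(T)},$$ where $T$ runs over the $(n-1,1)$-symplectic tableaux of shape $\lambda$ and $\alpha_a(T)$ is the number of occurrences of $a$ in $T$. An orthosymplectic tableau of shape $\lambda$ is a filling of the Young diagram of $\lambda$ with entries from $1<\overline 1<2<\overline 2<\cdots<n<\overline n<1'<\cdots<m'$ such that the entries increase weakly across rows and down columns, the unprimed entries (with or without bar) increase strictly down columns and those in the $i$-th row are $\ge i$, and the primed entries increase strictly across rows. The orthosymplectic Schur function is $$\mathrm{spo}_\lambda(x_1,\dots,x_n;y_1,\dots,y_m)=\sum_T\prod_{i=1}^n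 x_i^{n_i(T)-n_{\overline i}(T)}\prod_{j=1}^m y_j^{n_{j'}(T)},$$ where $T$ runs over the orthosymplectic tableaux of shape $\lambda$ and $n_a(T)$ is the number of occurrences of $a$ in $T$. Then, with $m=1$, $$\mathrm{sp}^{(n-1,1)}_\lambda(x_1,\dots,x_{n-1}\,|\,x_n)=\mathrm{spo}_\lambda(x_1,\dots,x_{n-1},x_n^{-1};-x_n^{-1}).$$ -/

import Mathlib

/-!
Partitions are Young diagrams: the cell `(i, j)` is the box in row `i` and column `j` (both counted
from `0`), and the length of `lam` is `lam.colLen 0`, the number of its non-empty rows.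
-/

/-- A filling of the boxes of `lam` with entries from the alphabet `B`. -/
abbrev Filling (lam : YoungDiagram) (B : Type*) : Type _ := lam.cells → B

/-- The number of occurrences of the letter `b` in the filling `T`. -/
def Filling.count {lam : YoungDiagram} {B : Type*} [DecidableEq B] (T : Filling lam B) (b : B) : ℕ :=
  (Finset.univ.filter fun c => T c = b).card

/-- The ordered alphabet `1 < 1̄ < 2 < 2̄ < ⋯ < n < n̄`: the pair `(i, false)` is the letter `i + 1`
and `(i, true)` is the barred letter. -/
abbrev SympLetter (n : ℕ) : Type := Fin n ×ₗ Bool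

/-- The unbarred letter with (zero-based) index `i`. -/
def SympLetter.plain {n : ℕ} (i : Fin n) : SympLetter n := toLex (i, false)

/-- The barred letter with (zero-based) index `i`. -/
def SympLetter.bar {n : ℕ} (i : Fin n) : SympLetter n := toLex (i, true)

/-- The (zero-based) index of a letter, forgetting the bar. In the order of the alphabet a letter is
`≥ i` exactly when its index is `≥ i`. -/
def SympLetter.index {n : ℕ} (b : SympLetter n) : ℕ := ((ofLex b).1 : ℕ)

/-- The ordered alphabet `1 < 1̄ < ⋯ < n < n̄ < 1' < ⋯ < m'`. -/
abbrev OSPLetter (n m : ℕ) : Type := SympLetter n ⊕ₗ Fin m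

/-- A letter of `1 < 1̄ < ⋯ < n < n̄`, as a letter of the larger alphabet. -/
def OSPLetter.symp {n m : ℕ} (b : SympLetter n) : OSPLetter n m := toLex (Sum.inl b)

/-- The primed letter with (zero-based) index `j`. -/
def OSPLetter.primed {n m : ℕ} (j : Fin m) : OSPLetter n m := toLex (Sum.inr j)

/-- Orthosymplectic tableaux. Weak increase along rows and columns says that the unprimed entries
occupy a Young diagram, the remaining conditions say that they form a symplectic tableau and that
the primed entries increase strictly across rows and weakly down columns. -/
structure IsOrthosymplecticTableau {n m : ℕ} {lam : YoungDiagram}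
    (T : Filling lam (OSPLetter n m)) : Prop where
  row_weak : ∀ c d : lam.cells, c.1.1 = d.1.1 → c.1.2 < d.1.2 → T c ≤ T d
  col_weak : ∀ c d : lam.cells, c.1.2 = d.1.2 → c.1.1 < d.1.1 → T c ≤ T d
  symp_col_strict : ∀ (c d : lam.cells) (b : SympLetter n), c.1.2 = d.1.2 → c.1.1 < d.1.1 →
    T d = OSPLetter.symp b → T c < T d
  symp_row_bound : ∀ (c : lam.cells) (b : SympLetter n), T c = OSPLetter.symp b → c.1.1 ≤ b.index
  primed_row_strict : ∀ (c d : lam.cells) (j : Fin m), c.1.1 = d.1.1 → c.1.2 < d.1.2 →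
    T c = OSPLetter.primed j → T c < T d

/-- The weight `∏ x_i ^ (n_i(T) - n_ī(T)) * ∏ y_j ^ n_j'(T)`. -/
def ospWeight {R : Type*} [CommRing R] {n m : ℕ} {lam : YoungDiagram} (x : Fin n → Rˣ) (y : Fin m → R)
    (T : Filling lam (OSPLetter n m)) : R :=
  ((∏ i, x i ^ ((T.count (OSPLetter.symp (SympLetter.plain i)) : ℤ) -
      (T.count (OSPLetter.symp (SympLetter.bar i)) : ℤ)) : Rˣ) : R) *
    ∏ j, y j ^ T.count (OSPLetter.primed j)

open Classical in
/-- The orthosymplectic Schur function `spo_lam(x_1, …, x_n; y_1, …, y_m)`, evaluated at invertible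
elements `x_i` and arbitrary elements `y_j` of a commutative ring. -/
noncomputable def orthosymplecticSchur {R : Type*} [CommRing R] {n m : ℕ} (lam : YoungDiagram)
    (x : Fin n → Rˣ) (y : Fin m → R) : R :=
  ∑ T : Filling lam (OSPLetter n m) with IsOrthosymplecticTableau T, ospWeight x y T

/-- The ordered alphabet `1 < 1̄ < ⋯ < k < k̄ < k + 1` of `(k, 1)`-symplectic tableaux. -/
abbrev OddLetter (k : ℕ) : Type := SympLetter k ⊕ₗ Unit

/-- A letter of `1 < 1̄ < ⋯ < k < k̄`, as a letter of the larger alphabet. -/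
def OddLetter.symp {k : ℕ} (b : SympLetter k) : OddLetter k := toLex (Sum.inl b)

/-- The largest letter `k + 1`, which has no barred partner. -/
def OddLetter.last {k : ℕ} : OddLetter k := toLex (Sum.inr ())

/-- The (zero-based) index of a letter, forgetting the bar; the last letter has index `k`. -/
def OddLetter.index {k : ℕ} (b : OddLetter k) : ℕ :=
  Sum.elim SympLetter.index (fun _ => k) (ofLex b)

/-- `(k, 1)`-symplectic tableaux: weakly increasing across rows, strictly increasing down columns,
and the entries of the `i`-th row are `≥ i`. -/
structure IsOddSymplecticTableau {k : ℕ} {lam : YoungDiagram}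
    (T : Filling lam (OddLetter k)) : Prop where
  row_weak : ∀ c d : lam.cells, c.1.1 = d.1.1 → c.1.2 < d.1.2 → T c ≤ T d
  col_strict : ∀ c d : lam.cells, c.1.2 = d.1.2 → c.1.1 < d.1.1 → T c < T d
  row_bound : ∀ c : lam.cells, c.1.1 ≤ (T c).index

/-- The weight `z ^ α(T) * ∏ x_i ^ (α_i(T) - α_ī(T))`, where `α(T)` counts the last letter. -/
def oddWeight {R : Type*} [CommRing R] {k : ℕ} {lam : YoungDiagram} (x : Fin k → Rˣ) (z : R)
    (T : Filling lam (OddLetter k)) : R :=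
  z ^ T.count OddLetter.last *
    ((∏ i, x i ^ ((T.count (OddLetter.symp (SympLetter.plain i)) : ℤ) -
      (T.count (OddLetter.symp (SympLetter.bar i)) : ℤ)) : Rˣ) : R)

open Classical in
/-- The odd symplectic character `sp^{(k,1)}_lam(x_1, …, x_k | z)`, evaluated at invertible elements
`x_i` and an element `z` of a commutative ring. -/
noncomputable def oddSymplecticCharacter {R : Type*} [CommRing R] {k : ℕ} (lam : YoungDiagram)
    (x : Fin k → Rˣ) (z : R) : R :=
  ∑ T : Filling lam (OddLetter k) with IsOddSymplecticTableau T, oddWeight x z T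

/-!
The letters `n`, `n̄` and `1'` of the orthosymplectic alphabet are collapsed to the last letter of
the odd alphabet, and the orthosymplectic tableaux are grouped by the resulting filling `B`.

Only fillings `B` whose smaller letters satisfy the tableau conditions (`IsSymplecticBase`) matter.
Let `μ` be the shape of the boxes of such a `B` which do not contain the last letter. The tableaux
which collapse to `B` are the chains `μ ⊆ ν ⊆ ρ ⊆ lam` in which `ν / μ` (letters `n`) and `ρ / ν`
(letters `n̄`) are horizontal strips and `lam / ρ` (letters `1'`) is a vertical strip
(`isOrthosymplecticTableau_iff`); the row bound on `n` and `n̄` holds because `lam` has at most `n`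
rows. At the given arguments the three letters have weights `t`, `s` and `-t`, where `s = x_n` and
`t = x_n⁻¹`. So the sum over the fibre is, up to the weight of the other letters, the supersymmetric
skew Schur function `s_{lam/μ}(t, s / -t)`, and it has to be shown that this is `s_{lam/μ}(s)`: that
is `s ^ |lam/μ|` if `lam / μ` is a horizontal strip, which is the condition for `B` to be an odd
symplectic tableau (`isOddSymplecticTableau_iff`), and `0` otherwise.

This identity is `sum_strip_cancel`. By symmetry in the variables `t` and `s`
(`sum_horizontalStrip_swap`), the variable `t` may be used for the second horizontal strip, next to
the vertical strip with variable `-t`. Then the sum over `ρ` factors over the rows and vanishes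
unless `ν = lam` (`sum_horizontalStrip_verticalStrip`).
-/

/-! ### Horizontal and vertical strips -/

/-- `ν / μ` is a horizontal strip: `μ ⊆ ν` and no two boxes of the difference lie in one column.
Shapes with at most `k + 1` rows are given by their row lengths; the shape condition on `μ` and `ν`
is implied. -/
def IsHorizontalStrip {k : ℕ} (μ ν : Fin (k + 1) → ℕ) : Prop :=
  (∀ i, μ i ≤ ν i) ∧ ∀ i j, i < j → ν j ≤ μ i

/-- `ν / μ` is a vertical strip: `μ ⊆ ν` and no two boxes of the difference lie in one row. -/
def IsVerticalStrip {k : ℕ} (μ ν : Fin (k + 1) → ℕ) : Prop :=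
  ∀ i, μ i ≤ ν i ∧ ν i ≤ μ i + 1

/-- The number of boxes of `ν / μ`, for `μ ⊆ ν`. -/
def skewSize {k : ℕ} (μ ν : Fin (k + 1) → ℕ) : ℕ := ∑ i, (ν i - μ i)

section Strips

variable {k : ℕ} {μ ν ρ : Fin (k + 1) → ℕ}

theorem isHorizontalStrip_iff_succ :
    IsHorizontalStrip μ ν ↔ (∀ i, μ i ≤ ν i) ∧ ∀ i : Fin k, ν i.succ ≤ μ i.castSucc := by
  refine and_congr_right fun h => ⟨fun h' i => h' _ _ i.castSucc_lt_succ, fun h' i j hij => ?_⟩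
  have hanti : Antitone μ := Fin.antitone_iff_succ_le.2 fun i => (h _).trans (h' i)
  obtain ⟨j, rfl⟩ := Fin.exists_succ_eq.2 (Fin.ne_zero_of_lt hij)
  exact (h' j).trans (hanti (Fin.le_castSucc_iff.2 hij))

theorem skewSize_add (h : ∀ i, μ i ≤ ν i) : skewSize μ ν + ∑ i, μ i = ∑ i, ν i := by
  rw [skewSize, ← Finset.sum_add_distrib]
  exact Finset.sum_congr rfl fun i _ => Nat.sub_add_cancel (h i)

/-- The least row lengths of a shape lying between `μ` and `ρ` with both steps horizontal strips. -/
def interlaceLower (μ ρ : Fin (k + 1) → ℕ) : Fin (k + 1) → ℕ :=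
  Fin.lastCases (μ (Fin.last k)) fun i => max (μ i.castSucc) (ρ i.succ)

/-- The greatest row lengths of a shape lying between `μ` and `ρ` with both steps horizontal
strips. -/
def interlaceUpper (μ ρ : Fin (k + 1) → ℕ) : Fin (k + 1) → ℕ :=
  Fin.cases (ρ 0) fun i => min (μ i.castSucc) (ρ i.succ)

/-- Interlacing puts independent conditions on the rows of the intermediate shape. -/
theorem isHorizontalStrip_and_iff :
    IsHorizontalStrip μ ν ∧ IsHorizontalStrip ν ρ ↔
      ∀ i, interlaceLower μ ρ i ≤ ν i ∧ ν i ≤ interlaceUpper μ ρ i := by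
  simp only [isHorizontalStrip_iff_succ, forall_and]
  rw [Fin.forall_fin_succ' (P := fun i => interlaceLower μ ρ i ≤ ν i),
    Fin.forall_fin_succ (P := fun i => ν i ≤ interlaceUpper μ ρ i),
    Fin.forall_fin_succ' (P := fun i => μ i ≤ ν i),
    Fin.forall_fin_succ (P := fun i => ν i ≤ ρ i)]
  simp only [interlaceLower, interlaceUpper, Fin.lastCases_castSucc, Fin.lastCases_last,
    Fin.cases_zero, Fin.cases_succ, max_le_iff, le_min_iff, forall_and]
  tauto

theorem sum_interlace (μ ρ : Fin (k + 1) → ℕ) :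
    ∑ i, interlaceLower μ ρ i + ∑ i, interlaceUpper μ ρ i = ∑ i, μ i + ∑ i, ρ i := by
  rw [Fin.sum_univ_castSucc (interlaceLower μ ρ), Fin.sum_univ_succ (interlaceUpper μ ρ),
    Fin.sum_univ_castSucc μ, Fin.sum_univ_succ ρ]
  simp only [interlaceLower, interlaceUpper, Fin.lastCases_castSucc, Fin.lastCases_last,
    Fin.cases_zero, Fin.cases_succ]
  have h : ∑ i : Fin k, max (μ i.castSucc) (ρ i.succ) + ∑ i : Fin k, min (μ i.castSucc) (ρ i.succ) =
      ∑ i : Fin k, μ i.castSucc + ∑ i : Fin k, ρ i.succ := by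
    simp only [← Finset.sum_add_distrib, max_add_min]
  omega

variable {R : Type*} [CommRing R]

open Classical in
/-- The skew Schur polynomial in two variables is symmetric. This is the Bender–Knuth involution,
which reflects every row of the intermediate shape in its range of admissible lengths. -/
theorem sum_horizontalStrip_swap (lam μ ρ : Fin (k + 1) → ℕ) (hρ : ρ ≤ lam) (s t : R) :
    (∑ ν ∈ Finset.Icc μ lam, if IsHorizontalStrip μ ν ∧ IsHorizontalStrip ν ρ then
        t ^ skewSize μ ν * s ^ skewSize ν ρ else 0) =
      ∑ ν ∈ Finset.Icc μ lam, if IsHorizontalStrip μ ν ∧ IsHorizontalStrip ν ρ then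
        s ^ skewSize μ ν * t ^ skewSize ν ρ else 0 := by
  rw [← Finset.sum_filter, ← Finset.sum_filter]
  let refl : (Fin (k + 1) → ℕ) → Fin (k + 1) → ℕ :=
    fun ν i => interlaceLower μ ρ i + interlaceUpper μ ρ i - ν i
  have key : ∀ ν, (IsHorizontalStrip μ ν ∧ IsHorizontalStrip ν ρ) →
      IsHorizontalStrip μ (refl ν) ∧ IsHorizontalStrip (refl ν) ρ := by
    intro ν hν
    rw [isHorizontalStrip_and_iff] at hν ⊢
    intro i
    have := hν i
    simp only [refl]
    omega
  have mem : ∀ ν, ν ∈ (Finset.Icc μ lam).filter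
      (fun ν => IsHorizontalStrip μ ν ∧ IsHorizontalStrip ν ρ) ↔
      IsHorizontalStrip μ ν ∧ IsHorizontalStrip ν ρ := by
    intro ν
    simp only [Finset.mem_filter, Finset.mem_Icc, and_iff_right_iff_imp]
    exact fun h => ⟨h.1.1, fun i => (h.2.1 i).trans (hρ i)⟩
  have invol : ∀ ν, (IsHorizontalStrip μ ν ∧ IsHorizontalStrip ν ρ) → refl (refl ν) = ν := by
    intro ν hν
    rw [isHorizontalStrip_and_iff] at hν
    funext i
    have := hν i
    simp only [refl]
    omega
  refine Finset.sum_nbij' refl refl (fun ν h => (mem _).2 (key _ ((mem _).1 h)))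
    (fun ν h => (mem _).2 (key _ ((mem _).1 h))) (fun ν h => invol _ ((mem _).1 h))
    (fun ν h => invol _ ((mem _).1 h)) fun ν h => ?_
  rw [mem] at h
  have h' := key _ h
  have hsum : ∑ i, refl ν i + ∑ i, ν i = ∑ i, μ i + ∑ i, ρ i := by
    rw [← sum_interlace μ ρ, ← Finset.sum_add_distrib, ← Finset.sum_add_distrib]
    refine Finset.sum_congr rfl fun i _ => ?_
    have := isHorizontalStrip_and_iff.1 h i
    simp only [refl]
    omega
  have e1 := skewSize_add h.1.1
  have e2 := skewSize_add h.2.1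
  have e3 := skewSize_add h'.1.1
  have e4 := skewSize_add h'.2.1
  rw [show skewSize μ (refl ν) = skewSize ν ρ by omega,
    show skewSize (refl ν) ρ = skewSize μ ν by omega, mul_comm]

open Classical in
/-- The variables `t` (for a horizontal strip) and `-t` (for a vertical strip) cancel. The sum is a
product over the rows; if `ν ≠ lam`, the factor of the first row where the two shapes differ
vanishes. -/
theorem sum_horizontalStrip_verticalStrip (lam μ ν : Fin (k + 1) → ℕ) (hlam : Antitone lam)
    (hμν : μ ≤ ν) (hν : ν ≤ lam) (t : R) :
    (∑ ρ ∈ Finset.Icc μ lam, if IsHorizontalStrip ν ρ ∧ IsVerticalStrip ρ lam then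
        t ^ skewSize ν ρ * (-t) ^ skewSize ρ lam else 0) = if ν = lam then 1 else 0 := by
  rw [← Finset.sum_filter]
  have hset : (Finset.Icc μ lam).filter
      (fun ρ => IsHorizontalStrip ν ρ ∧ IsVerticalStrip ρ lam) =
      Fintype.piFinset fun i =>
        Finset.Icc (max (ν i) (lam i - 1)) (interlaceUpper ν lam i) := by
    ext ρ
    have hup : (∀ i, ρ i ≤ interlaceUpper ν lam i) ↔
        (∀ i, ρ i ≤ lam i) ∧ ∀ i : Fin k, ρ i.succ ≤ ν i.castSucc := by
      rw [Fin.forall_fin_succ, Fin.forall_fin_succ (P := fun i => ρ i ≤ lam i)]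
      simp only [interlaceUpper, Fin.cases_zero, Fin.cases_succ, le_min_iff, forall_and]
      tauto
    simp only [Finset.mem_filter, Finset.mem_Icc, Fintype.mem_piFinset, max_le_iff, forall_and,
      isHorizontalStrip_iff_succ, IsVerticalStrip, hup, tsub_le_iff_right]
    constructor
    · rintro ⟨-, ⟨h1, h2⟩, h3, h4⟩
      exact ⟨⟨h1, h4⟩, h3, h2⟩
    · rintro ⟨⟨h1, h4⟩, h3, h2⟩
      exact ⟨⟨fun i => (hμν i).trans (h1 i), h3⟩, ⟨h1, h2⟩, h3, h4⟩
  rw [hset]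
  simp only [skewSize, ← Finset.prod_pow_eq_pow_sum, ← Finset.prod_mul_distrib]
  rw [← Finset.prod_univ_sum (fun i => Finset.Icc (max (ν i) (lam i - 1)) (interlaceUpper ν lam i))
    fun i a => t ^ (a - ν i) * (-t) ^ (lam i - a)]
  split_ifs with h
  · subst h
    refine Finset.prod_eq_one fun i _ => ?_
    have hi : interlaceUpper ν ν i = ν i := by
      induction i using Fin.cases with
      | zero => rfl
      | succ i => exact min_eq_right (hlam i.castSucc_lt_succ.le)
    simp [hi]
  · have hex : ∃ i, ν i < lam i := by
      by_contra! hc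
      exact h (le_antisymm hν hc)
    obtain ⟨i, hi, hmin⟩ := WellFounded.has_min (wellFounded_lt (α := Fin (k + 1)))
      {i | ν i < lam i} hex
    refine Finset.prod_eq_zero (Finset.mem_univ i) ?_
    have hui : interlaceUpper ν lam i = lam i := by
      induction i using Fin.cases with
      | zero => rfl
      | succ i =>
        refine min_eq_right ((hlam i.castSucc_lt_succ.le).trans ?_)
        exact not_lt.1 fun hc => hmin i.castSucc hc i.castSucc_lt_succ
    change ν i < lam i at hi
    obtain ⟨d, hd⟩ : ∃ d, lam i = ν i + d + 1 := ⟨lam i - ν i - 1, by omega⟩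
    rw [hui, max_eq_right (by omega), hd, Nat.add_sub_cancel, Finset.sum_Icc_succ_top (by omega)]
    rw [Finset.Icc_self, Finset.sum_singleton, show ν i + d - ν i = d by omega,
      show ν i + d + 1 - ν i = d + 1 by omega,
      show ν i + d + 1 - (ν i + d) = 1 by omega, Nat.sub_self]
    ring

open Classical in
/-- The supersymmetric skew Schur function `s_{lam/μ}(t, s / -t)` equals `s_{lam/μ}(s)`. -/
theorem sum_strip_cancel (lam μ : Fin (k + 1) → ℕ) (hlam : Antitone lam) (hμ : μ ≤ lam) (s t : R) :
    (∑ p ∈ Finset.Icc μ lam ×ˢ Finset.Icc μ lam with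
        IsHorizontalStrip μ p.1 ∧ IsHorizontalStrip p.1 p.2 ∧ IsVerticalStrip p.2 lam,
        t ^ skewSize μ p.1 * s ^ skewSize p.1 p.2 * (-t) ^ skewSize p.2 lam) =
      if IsHorizontalStrip μ lam then s ^ skewSize μ lam else 0 := by
  rw [Finset.sum_filter, Finset.sum_product_right]
  calc _ = ∑ ρ ∈ Finset.Icc μ lam, (if IsVerticalStrip ρ lam then (-t) ^ skewSize ρ lam else 0) *
        ∑ ν ∈ Finset.Icc μ lam, if IsHorizontalStrip μ ν ∧ IsHorizontalStrip ν ρ then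
          t ^ skewSize μ ν * s ^ skewSize ν ρ else 0 := by
        refine Finset.sum_congr rfl fun ρ _ => ?_
        rw [Finset.mul_sum]
        refine Finset.sum_congr rfl fun ν _ => ?_
        by_cases h1 : IsHorizontalStrip μ ν <;> by_cases h2 : IsHorizontalStrip ν ρ <;>
          by_cases h3 : IsVerticalStrip ρ lam <;> simp [h1, h2, h3, mul_comm]
    _ = ∑ ρ ∈ Finset.Icc μ lam, (if IsVerticalStrip ρ lam then (-t) ^ skewSize ρ lam else 0) *
        ∑ ν ∈ Finset.Icc μ lam, if IsHorizontalStrip μ ν ∧ IsHorizontalStrip ν ρ then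
          s ^ skewSize μ ν * t ^ skewSize ν ρ else 0 := by
        refine Finset.sum_congr rfl fun ρ hρ => ?_
        rw [sum_horizontalStrip_swap lam μ ρ (Finset.mem_Icc.1 hρ).2]
    _ = ∑ ν ∈ Finset.Icc μ lam, (if IsHorizontalStrip μ ν then s ^ skewSize μ ν else 0) *
        ∑ ρ ∈ Finset.Icc μ lam, if IsHorizontalStrip ν ρ ∧ IsVerticalStrip ρ lam then
          t ^ skewSize ν ρ * (-t) ^ skewSize ρ lam else 0 := by
        simp only [Finset.mul_sum]
        rw [Finset.sum_comm]
        refine Finset.sum_congr rfl fun ν _ => Finset.sum_congr rfl fun ρ _ => ?_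
        by_cases h1 : IsHorizontalStrip μ ν <;> by_cases h2 : IsHorizontalStrip ν ρ <;>
          by_cases h3 : IsVerticalStrip ρ lam <;> simp [h1, h2, h3]
        ring
    _ = ∑ ν ∈ Finset.Icc μ lam, (if IsHorizontalStrip μ ν then s ^ skewSize μ ν else 0) *
        if ν = lam then 1 else 0 := by
        refine Finset.sum_congr rfl fun ν hν => ?_
        rw [sum_horizontalStrip_verticalStrip lam μ ν hlam (Finset.mem_Icc.1 hν).1
          (Finset.mem_Icc.1 hν).2]
    _ = _ := by
        simp [hμ]

end Strips

/-! ### Row profiles of sets of boxes -/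

section Profiles

variable {k : ℕ} {lam : YoungDiagram}

theorem cell_fst_lt (h : lam.colLen 0 ≤ k + 1) (c : lam.cells) : c.1.1 < k + 1 :=
  ((YoungDiagram.mem_iff_lt_colLen.1 ((YoungDiagram.mem_cells _).1 c.2)).trans_le
    (lam.colLen_anti _ _ (Nat.zero_le _))).trans_le h

/-- The row of a box of a diagram with at most `k + 1` rows. -/
def cellRow (h : lam.colLen 0 ≤ k + 1) (c : lam.cells) : Fin (k + 1) := ⟨c.1.1, cell_fst_lt h c⟩

/-- The row lengths of a diagram with at most `k + 1` rows. -/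
def rowLens (k : ℕ) (lam : YoungDiagram) (i : Fin (k + 1)) : ℕ := lam.rowLen i

theorem rowLens_antitone : Antitone (rowLens k lam) := fun _ _ hij => lam.rowLen_anti _ _ hij

/-- The box in row `i` and column `j`. -/
def mkCell {i : Fin (k + 1)} {j : ℕ} (hj : j < rowLens k lam i) : lam.cells :=
  ⟨(i, j), (YoungDiagram.mem_cells _).2 (YoungDiagram.mem_iff_lt_rowLen.2 hj)⟩

theorem cell_snd_lt (h : lam.colLen 0 ≤ k + 1) (c : lam.cells) :
    c.1.2 < rowLens k lam (cellRow h c) :=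
  YoungDiagram.mem_iff_lt_rowLen.1 ((YoungDiagram.mem_cells _).1 c.2)

/-- The boxes with property `P` are, in each row `i`, the first `f i` ones. -/
structure IsRowProfile (h : lam.colLen 0 ≤ k + 1) (P : lam.cells → Prop)
    (f : Fin (k + 1) → ℕ) : Prop where
  le : f ≤ rowLens k lam
  iff : ∀ c, P c ↔ c.1.2 < f (cellRow h c)

variable {h : lam.colLen 0 ≤ k + 1} {P Q : lam.cells → Prop} {f g : Fin (k + 1) → ℕ}

theorem IsRowProfile.mono (hf : IsRowProfile h P f) (hg : IsRowProfile h Q g)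
    (hPQ : ∀ c, P c → Q c) : f ≤ g := by
  intro i
  by_contra! hc
  have hl : g i < rowLens k lam i := hc.trans_le (hf.le i)
  exact lt_irrefl _ ((hg.iff (mkCell hl)).1 (hPQ _ ((hf.iff (mkCell hl)).2 hc)))

theorem IsRowProfile.unique (hf : IsRowProfile h P f) (hg : IsRowProfile h P g) : f = g :=
  le_antisymm (hf.mono hg fun _ => id) (hg.mono hf fun _ => id)

theorem isRowProfile_true : IsRowProfile h (fun _ => True) (rowLens k lam) :=
  ⟨le_rfl, fun c => iff_of_true trivial (cell_snd_lt h c)⟩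

/-- The number of boxes of a left-justified set of boxes in each row: the least column beyond all
boxes of the set in that row. -/
noncomputable def rowProfile (k : ℕ) (P : lam.cells → Prop) (i : Fin (k + 1)) : ℕ :=
  sInf {j | ∀ c : lam.cells, c.1.1 = i → P c → c.1.2 < j}

theorem isRowProfile_rowProfile (h : lam.colLen 0 ≤ k + 1)
    (hP : ∀ c d : lam.cells, c.1.1 = d.1.1 → c.1.2 < d.1.2 → P d → P c) :
    IsRowProfile h P (rowProfile k P) := by
  have hmem : ∀ i : Fin (k + 1),
      rowLens k lam i ∈ {j | ∀ c : lam.cells, c.1.1 = i → P c → c.1.2 < j} := by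
    intro i c hc _
    have := cell_snd_lt h c
    rwa [show cellRow h c = i from Fin.ext hc] at this
  refine ⟨fun i => Nat.sInf_le (hmem i), fun c => ⟨fun hc => ?_, fun hc => ?_⟩⟩
  · exact Nat.sInf_mem ⟨_, hmem (cellRow h c)⟩ c rfl hc
  · have := Nat.notMem_of_lt_sInf hc
    simp only [Set.mem_ofPred_eq, not_forall, not_lt] at this
    obtain ⟨d, hd, hPd, hle⟩ := this
    rcases hle.eq_or_lt with he | hl
    · rwa [show c = d from Subtype.ext (Prod.ext hd.symm he)]
    · exact hP c d hd.symm hl hPd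

/-- If every box strictly above a box of the larger set lies in the smaller set, the difference is a
horizontal strip. -/
theorem IsRowProfile.isHorizontalStrip (hf : IsRowProfile h P f) (hg : IsRowProfile h Q g)
    (hPQ : ∀ c, P c → Q c)
    (hcol : ∀ c d : lam.cells, c.1.2 = d.1.2 → c.1.1 < d.1.1 → Q d → P c) :
    IsHorizontalStrip f g := by
  refine ⟨hf.mono hg hPQ, fun i j hij => ?_⟩
  by_contra! hc
  have hj : f i < rowLens k lam j := hc.trans_le (hg.le j)
  have hi : f i < rowLens k lam i := hj.trans_le (rowLens_antitone hij.le)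
  exact lt_irrefl _ ((hf.iff (mkCell hi)).1
    (hcol (mkCell hi) (mkCell hj) rfl hij ((hg.iff (mkCell hj)).2 hc)))

theorem IsRowProfile.of_isHorizontalStrip (hf : IsRowProfile h P f) (hg : IsRowProfile h Q g)
    (hfg : IsHorizontalStrip f g) {c d : lam.cells} (hcd : c.1.2 = d.1.2) (hlt : c.1.1 < d.1.1)
    (hd : Q d) : P c := by
  rw [hg.iff] at hd
  rw [hf.iff, hcd]
  exact hd.trans_le (hfg.2 _ _ hlt)

theorem IsRowProfile.card [DecidablePred P] (hf : IsRowProfile h P f) :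
    (Finset.univ.filter P).card = ∑ i, f i := by
  rw [Finset.card_eq_sum_card_fiberwise (f := cellRow h) (t := Finset.univ) (by simp)]
  refine Finset.sum_congr rfl fun i _ => ?_
  rw [← Finset.card_range (f i)]
  refine Finset.card_bij (fun c _ => c.1.2) ?_ ?_ ?_
  · intro c hc
    simp only [Finset.mem_filter, Finset.mem_univ, true_and] at hc
    rw [Finset.mem_range, ← hc.2]
    exact (hf.iff c).1 hc.1
  · intro c hc d hd hcd
    simp only [Finset.mem_filter, Finset.mem_univ, true_and] at hc hd
    exact Subtype.ext (Prod.ext (congrArg Fin.val (hc.2.trans hd.2.symm)) hcd)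
  · intro j hj
    have hj := Finset.mem_range.1 hj
    refine ⟨mkCell (hj.trans_le (hf.le i)), ?_, rfl⟩
    simp only [Finset.mem_filter, Finset.mem_univ, true_and]
    exact ⟨(hf.iff _).2 hj, rfl⟩

theorem IsRowProfile.card_sdiff {S : lam.cells → Prop} [DecidablePred S]
    (hf : IsRowProfile h P f) (hg : IsRowProfile h Q g) (hPQ : ∀ c, P c → Q c)
    (hS : ∀ c, S c ↔ Q c ∧ ¬ P c) :
    (Finset.univ.filter S).card = skewSize f g := by
  classical
  have h1 := skewSize_add (hf.mono hg hPQ)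
  rw [← hf.card, ← hg.card] at h1
  have h2 : Finset.univ.filter Q = Finset.univ.filter S ∪ Finset.univ.filter P := by
    ext c
    have := hPQ c
    simp only [Finset.mem_filter, Finset.mem_univ, true_and, Finset.mem_union, hS]
    tauto
  rw [h2, Finset.card_union_of_disjoint] at h1
  · omega
  · exact Finset.disjoint_filter.2 fun c _ h3 h4 => ((hS c).1 h3).2 h4

end Profiles

/-! ### Collapsing the three largest letters -/

namespace OddLetter

variable {k : ℕ}

theorem symp_ne_last (b : SympLetter k) : symp b ≠ last :=
  Sum.inl_ne_inr

theorem symp_injective : Function.Injective (symp (k := k)) :=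
  Sum.inl_injective

theorem cases (a : OddLetter k) :
    (∃ b, a = symp b) ∨ a = last := by
  rcases a with b | u
  · exact Or.inl ⟨b, rfl⟩
  · exact Or.inr rfl

theorem symp_lt_last (b : SympLetter k) : symp b < last :=
  Sum.Lex.inl_lt_inr _ _

theorem le_last (a : OddLetter k) : a ≤ last := by
  rcases a.cases with ⟨b, rfl⟩ | rfl
  · exact (symp_lt_last b).le
  · exact le_rfl

theorem symp_lt_symp_iff {b c : SympLetter k} :
    symp b < symp c ↔ b < c := Sum.Lex.inl_lt_inl_iff

end OddLetter

namespace OSPLetter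

variable {k : ℕ}

/-- A letter of `1 < 1̄ < ⋯ < k < k̄` in the alphabet `1 < 1̄ < ⋯ < k + 1 < (k + 1)‾ < 1'`. -/
def small (b : SympLetter k) : OSPLetter (k + 1) 1 :=
  symp (toLex ((ofLex b).1.castSucc, (ofLex b).2))

/-- The letter `k + 1` of the alphabet `1 < 1̄ < ⋯ < k + 1 < (k + 1)‾ < 1'`. -/
def top : OSPLetter (k + 1) 1 := symp (SympLetter.plain (Fin.last k))

/-- The barred letter `k + 1` of the alphabet `1 < 1̄ < ⋯ < k + 1 < (k + 1)‾ < 1'`. -/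
def topBar : OSPLetter (k + 1) 1 := symp (SympLetter.bar (Fin.last k))

/-- The letter `1'` of the alphabet `1 < 1̄ < ⋯ < k + 1 < (k + 1)‾ < 1'`. -/
def prime : OSPLetter (k + 1) 1 := primed 0

theorem cases (a : OSPLetter (k + 1) 1) :
    (∃ b, a = small b) ∨ a = top ∨ a = topBar ∨ a = prime := by
  rcases a with ⟨i, b⟩ | j
  · induction i using Fin.lastCases with
    | last => cases b
              · exact Or.inr (Or.inl rfl)
              · exact Or.inr (Or.inr (Or.inl rfl))
    | cast i => exact Or.inl ⟨toLex (i, b), rfl⟩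
  · exact Or.inr (Or.inr (Or.inr (by rw [Subsingleton.elim j 0]; rfl)))

theorem small_strictMono : StrictMono (small (k := k)) := by
  intro b c hbc
  refine Sum.Lex.inl_lt_inl_iff.2 ?_
  rw [Prod.Lex.lt_iff] at hbc ⊢
  simpa using hbc

theorem small_lt_top (b : SympLetter k) : small b < top :=
  Sum.Lex.inl_lt_inl_iff.2 (Prod.Lex.lt_iff.2 (Or.inl (Fin.castSucc_lt_last _)))

theorem top_lt_topBar : (top : OSPLetter (k + 1) 1) < topBar :=
  Sum.Lex.inl_lt_inl_iff.2 (Prod.Lex.lt_iff.2 (Or.inr ⟨rfl, Bool.false_lt_true⟩))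

theorem topBar_lt_prime : (topBar : OSPLetter (k + 1) 1) < prime := Sum.Lex.inl_lt_inr _ _

/-- The map which sends the three largest letters `k + 1`, `(k + 1)‾` and `1'` to the largest letter
of the odd alphabet, and is the identity on the other letters. -/
noncomputable def collapse (a : OSPLetter (k + 1) 1) : OddLetter k :=
  if hi : ∃ b, a = small b then OddLetter.symp hi.choose else OddLetter.last

theorem collapse_small (b : SympLetter k) : collapse (small b) = OddLetter.symp b := by
  have hi : ∃ c, small b = small c := ⟨b, rfl⟩
  rw [collapse, dif_pos hi, ← small_strictMono.injective hi.choose_spec]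

theorem collapse_of_le {a : OSPLetter (k + 1) 1} (ha : top ≤ a) : collapse a = OddLetter.last := by
  rw [collapse, dif_neg]
  rintro ⟨b, rfl⟩
  exact absurd ha (not_le.2 (small_lt_top b))

theorem small_or_top_le (a : OSPLetter (k + 1) 1) : (∃ b, a = small b) ∨ top ≤ a := by
  rcases a.cases with h | rfl | rfl | rfl
  · exact Or.inl h
  · exact Or.inr le_rfl
  · exact Or.inr top_lt_topBar.le
  · exact Or.inr (top_lt_topBar.trans topBar_lt_prime).le

theorem collapse_eq_symp_iff {a : OSPLetter (k + 1) 1} {b : SympLetter k} :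
    collapse a = OddLetter.symp b ↔ a = small b := by
  rcases a.small_or_top_le with ⟨c, rfl⟩ | h
  · rw [collapse_small, OddLetter.symp_injective.eq_iff, small_strictMono.injective.eq_iff]
  · rw [collapse_of_le h]
    refine iff_of_false (OddLetter.symp_ne_last b).symm ?_
    rintro rfl
    exact absurd h (not_le.2 (small_lt_top b))

theorem collapse_eq_last_iff {a : OSPLetter (k + 1) 1} :
    collapse a = OddLetter.last ↔ top ≤ a := by
  refine ⟨fun h => ?_, collapse_of_le⟩
  rcases a.small_or_top_le with ⟨c, rfl⟩ | h'
  · rw [collapse_small] at h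
    exact absurd h (OddLetter.symp_ne_last c)
  · exact h'

theorem collapse_ne_last_iff {a : OSPLetter (k + 1) 1} :
    collapse a ≠ OddLetter.last ↔ a < top := by
  rw [Ne, collapse_eq_last_iff, not_le]

theorem collapse_monotone : Monotone (collapse (k := k)) := by
  intro a b hab
  rcases b.small_or_top_le with ⟨c, rfl⟩ | h
  · rcases a.small_or_top_le with ⟨d, rfl⟩ | h'
    · rw [collapse_small, collapse_small]
      exact Sum.Lex.inl_le_inl_iff.2 (small_strictMono.le_iff_le.1 hab)
    · exact absurd (h'.trans hab) (not_le.2 (small_lt_top c))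
  · rw [collapse_of_le h]
    exact OddLetter.le_last _

theorem lt_small_of_collapse_lt {a : OSPLetter (k + 1) 1} {b : SympLetter k}
    (h : collapse a < OddLetter.symp b) : a < small b := by
  by_contra! hc
  have := collapse_monotone hc
  rw [collapse_small] at this
  exact absurd h (not_lt.2 this)

theorem le_topBar_of_ne_prime {a : OSPLetter (k + 1) 1} (h : a ≠ prime) : a ≤ topBar := by
  rcases a.cases with ⟨b, rfl⟩ | rfl | rfl | rfl
  · exact ((small_lt_top b).trans top_lt_topBar).le
  · exact top_lt_topBar.le
  · exact le_rfl
  · exact absurd rfl h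

theorem le_top_of_lt_topBar {a : OSPLetter (k + 1) 1} (h : a < topBar) : a ≤ top := by
  rcases a.cases with ⟨b, rfl⟩ | rfl | rfl | rfl
  · exact (small_lt_top b).le
  · exact le_rfl
  · exact absurd h (lt_irrefl _)
  · exact absurd (h.trans topBar_lt_prime) (lt_irrefl _)

/-- The order of the alphabet is determined by the collapsed letter and by the position relative to
the letters `k + 1` and `(k + 1)‾`. -/
theorem le_of_collapse_le {a b : OSPLetter (k + 1) 1} (h : collapse a ≤ collapse b)
    (h1 : b ≤ top → a ≤ top) (h2 : b ≤ topBar → a ≤ topBar) : a ≤ b := by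
  rcases b.cases with ⟨c, rfl⟩ | rfl | rfl | rfl
  · by_contra! hc
    have hne : collapse a ≠ OddLetter.last := by
      rintro he
      rw [he, collapse_small] at h
      exact absurd (OddLetter.symp_lt_last c) (not_lt.2 h)
    obtain ⟨d, rfl⟩ := a.small_or_top_le.resolve_right fun h' => hne (collapse_of_le h')
    rw [collapse_small, collapse_small] at h
    exact absurd (OddLetter.symp_lt_symp_iff.2 (small_strictMono.lt_iff_lt.1 hc)) (not_lt.2 h)
  · exact h1 le_rfl
  · exact h2 le_rfl
  · by_cases ha : a = prime
    · exact ha.le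
    · exact (le_topBar_of_ne_prime ha).trans topBar_lt_prime.le

theorem symp_ne_prime (b : SympLetter (k + 1)) : (symp b : OSPLetter (k + 1) 1) ≠ prime :=
  Sum.inl_ne_inr

theorem symp_injective : Function.Injective (symp (n := k + 1) (m := 1)) := Sum.inl_injective

end OSPLetter

/-! ### Tableaux with a given collapse -/

section Tableaux

variable {k : ℕ} {lam : YoungDiagram}

open OSPLetter

/-- The conditions on the letters below the largest one, common to odd symplectic tableaux and to
the collapses of orthosymplectic tableaux: here the largest letter may be repeated in a column. -/
structure IsSymplecticBase (B : Filling lam (OddLetter k)) : Prop where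
  row_weak : ∀ c d : lam.cells, c.1.1 = d.1.1 → c.1.2 < d.1.2 → B c ≤ B d
  col_weak : ∀ c d : lam.cells, c.1.2 = d.1.2 → c.1.1 < d.1.1 → B c ≤ B d
  symp_col_strict : ∀ (c d : lam.cells) (b : SympLetter k), c.1.2 = d.1.2 → c.1.1 < d.1.1 →
    B d = OddLetter.symp b → B c < B d
  symp_row_bound : ∀ (c : lam.cells) (b : SympLetter k), B c = OddLetter.symp b → c.1.1 ≤ b.index

/-- The filling obtained by collapsing the three largest letters. -/
noncomputable def collapseFilling (T : Filling lam (OSPLetter (k + 1) 1)) :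
    Filling lam (OddLetter k) := fun c => collapse (T c)

theorem IsOrthosymplecticTableau.isSymplecticBase {T : Filling lam (OSPLetter (k + 1) 1)}
    (hT : IsOrthosymplecticTableau T) : IsSymplecticBase (collapseFilling T) where
  row_weak c d h1 h2 := collapse_monotone (hT.row_weak c d h1 h2)
  col_weak c d h1 h2 := collapse_monotone (hT.col_weak c d h1 h2)
  symp_col_strict c d b h1 h2 hb := by
    have hd : T d = small b := collapse_eq_symp_iff.1 hb
    have hlt := hT.symp_col_strict c d _ h1 h2 hd
    obtain ⟨a, ha⟩ := (T c).small_or_top_le.resolve_right fun h' =>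
      absurd (h'.trans hlt.le) (by rw [hd]; exact not_le.2 (small_lt_top b))
    rw [ha, hd] at hlt
    simp only [collapseFilling, ha, hd, collapse_small]
    exact OddLetter.symp_lt_symp_iff.2 (small_strictMono.lt_iff_lt.1 hlt)
  symp_row_bound c b hb := hT.symp_row_bound c _ (collapse_eq_symp_iff.1 hb)

theorem isRowProfile_base (h : lam.colLen 0 ≤ k + 1) {B : Filling lam (OddLetter k)}
    (hB : IsSymplecticBase B) :
    IsRowProfile h (fun c => B c ≠ OddLetter.last)
      (rowProfile k fun c => B c ≠ OddLetter.last) := by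
  refine isRowProfile_rowProfile h fun c d h1 h2 hd hc => hd ?_
  exact le_antisymm (OddLetter.le_last _) (hc ▸ hB.row_weak c d h1 h2)

theorem isOddSymplecticTableau_iff (h : lam.colLen 0 ≤ k + 1) {B : Filling lam (OddLetter k)} :
    IsOddSymplecticTableau B ↔ IsSymplecticBase B ∧
      IsHorizontalStrip (rowProfile k fun c => B c ≠ OddLetter.last) (rowLens k lam) := by
  constructor
  · intro hT
    have hB : IsSymplecticBase B :=
      { row_weak := hT.row_weak
        col_weak := fun c d h1 h2 => (hT.col_strict c d h1 h2).le
        symp_col_strict := fun c d _ h1 h2 _ => hT.col_strict c d h1 h2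
        symp_row_bound := fun c b hb => by
          have := hT.row_bound c
          rwa [hb] at this }
    refine ⟨hB, (isRowProfile_base h hB).isHorizontalStrip isRowProfile_true
      (fun _ _ => trivial) fun c d h1 h2 _ => ?_⟩
    exact ((hT.col_strict c d h1 h2).trans_le (OddLetter.le_last _)).ne
  · rintro ⟨hB, hstrip⟩
    refine ⟨hB.row_weak, fun c d h1 h2 => ?_, fun c => ?_⟩
    · rcases (B d).cases with ⟨b, hb⟩ | hd
      · exact hB.symp_col_strict c d b h1 h2 hb
      · rw [hd]
        exact lt_of_le_of_ne (OddLetter.le_last _)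
          ((isRowProfile_base h hB).of_isHorizontalStrip isRowProfile_true hstrip h1 h2 trivial)
    · rcases (B c).cases with ⟨b, hb⟩ | hc
      · rw [hb]
        exact hB.symp_row_bound c b hb
      · rw [hc]
        exact Nat.le_of_lt_succ (cell_fst_lt h c)

/-- The orthosymplectic conditions, in terms of the three shapes `μ ⊆ ν ⊆ ρ` occupied by the letters
`< k + 1`, `≤ k + 1` and `≤ (k + 1)‾`. The row bound on the letters `k + 1` and `(k + 1)‾` holds
automatically, since there are at most `k + 1` rows. -/
theorem isOrthosymplecticTableau_iff {h : lam.colLen 0 ≤ k + 1}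
    {T : Filling lam (OSPLetter (k + 1) 1)} (hB : IsSymplecticBase (collapseFilling T))
    {μ ν ρ : Fin (k + 1) → ℕ} (hμ : IsRowProfile h (fun c => T c < top) μ)
    (hν : IsRowProfile h (fun c => T c ≤ top) ν)
    (hρ : IsRowProfile h (fun c => T c ≤ topBar) ρ) :
    IsOrthosymplecticTableau T ↔ IsHorizontalStrip μ ν ∧ IsHorizontalStrip ν ρ ∧
      IsVerticalStrip ρ (rowLens k lam) := by
  constructor
  · intro hT
    refine ⟨hμ.isHorizontalStrip hν (fun _ => le_of_lt) fun c d h1 h2 hd => ?_,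
      hν.isHorizontalStrip hρ (fun _ hc => hc.trans top_lt_topBar.le) fun c d h1 h2 hd => ?_,
      fun i => ⟨hρ.le i, ?_⟩⟩
    · refine lt_of_lt_of_le ?_ hd
      rcases (T d).cases with ⟨b, hb⟩ | hb | hb | hb
      · exact hT.symp_col_strict c d _ h1 h2 hb
      · exact hT.symp_col_strict c d _ h1 h2 hb
      · exact hT.symp_col_strict c d _ h1 h2 hb
      · rw [hb] at hd
        exact absurd (top_lt_topBar.trans topBar_lt_prime) (not_lt.2 hd)
    · refine le_top_of_lt_topBar (lt_of_lt_of_le ?_ hd)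
      rcases (T d).cases with ⟨b, hb⟩ | hb | hb | hb
      · exact hT.symp_col_strict c d _ h1 h2 hb
      · exact hT.symp_col_strict c d _ h1 h2 hb
      · exact hT.symp_col_strict c d _ h1 h2 hb
      · rw [hb] at hd
        exact absurd topBar_lt_prime (not_lt.2 hd)
    · by_contra! hc
      -- The boxes in columns `ρ i` and `ρ i + 1` of row `i` both contain the primed letter.
      have hprime : ∀ j (hj : j < rowLens k lam i), ρ i ≤ j → T (mkCell hj) = prime := by
        intro j hj hle
        by_contra hne
        exact absurd ((hρ.iff (mkCell hj)).1 (le_topBar_of_ne_prime hne)) (not_lt.2 hle)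
      have hi : ρ i < rowLens k lam i := (Nat.lt_succ_self _).trans hc
      have := hT.primed_row_strict (mkCell hi) (mkCell hc) 0 rfl (Nat.lt_succ_self _)
        (hprime _ hi le_rfl)
      rw [hprime _ hi le_rfl, hprime _ hc (Nat.le_succ _)] at this
      exact lt_irrefl _ this
  · rintro ⟨hs1, hs2, hv⟩
    refine ⟨fun c d h1 h2 => ?_, fun c d h1 h2 => ?_, fun c d b h1 h2 hd => ?_, fun c b hc => ?_,
      fun c d j h1 h2 hc => ?_⟩
    · have hrow : cellRow h c = cellRow h d := Fin.ext h1
      refine le_of_collapse_le (hB.row_weak c d h1 h2) (fun hd => ?_) fun hd => ?_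
      · rw [hν.iff, ← hrow] at hd
        exact (hν.iff c).2 (h2.trans hd)
      · rw [hρ.iff, ← hrow] at hd
        exact (hρ.iff c).2 (h2.trans hd)
    · exact le_of_collapse_le (hB.col_weak c d h1 h2)
        (fun hd => (hμ.of_isHorizontalStrip hν hs1 h1 h2 hd).le)
        fun hd => (hν.of_isHorizontalStrip hρ hs2 h1 h2 hd).trans top_lt_topBar.le
    · rcases (T d).cases with ⟨b, hb⟩ | hb | hb | hb
      · have hb' : collapseFilling T d = OddLetter.symp b := collapse_eq_symp_iff.2 hb
        have := hB.symp_col_strict c d b h1 h2 hb'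
        rw [hb'] at this
        rw [hb]
        exact lt_small_of_collapse_lt this
      · rw [hb]
        exact hμ.of_isHorizontalStrip hν hs1 h1 h2 hb.le
      · rw [hb]
        exact (hν.of_isHorizontalStrip hρ hs2 h1 h2 hb.le).trans_lt top_lt_topBar
      · exact absurd (hd.symm.trans hb) (symp_ne_prime b)
    · have hlast : c.1.1 ≤ k := Nat.le_of_lt_succ (cell_fst_lt h c)
      rcases (T c).cases with ⟨a, ha⟩ | ha | ha | ha
      · rw [symp_injective (hc.symm.trans ha)]
        exact hB.symp_row_bound c a (collapse_eq_symp_iff.2 ha)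
      · rw [symp_injective (hc.symm.trans ha)]
        exact hlast
      · rw [symp_injective (hc.symm.trans ha)]
        exact hlast
      · exact absurd (hc.symm.trans ha) (symp_ne_prime b)
    · rw [Subsingleton.elim j 0] at hc
      have h3 : ¬ T c ≤ topBar := by
        rw [hc]
        exact not_le.2 topBar_lt_prime
      rw [hρ.iff, not_lt] at h3
      have h4 := cell_snd_lt h d
      rw [← show cellRow h c = cellRow h d from Fin.ext h1] at h4
      have h5 := (hv (cellRow h c)).2
      omega

/-- The filling which refines `B` by replacing the largest letter by `k + 1`, `(k + 1)‾` and `1'`,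
such that the letters `≤ k + 1` and `≤ (k + 1)‾` fill the shapes `ν` and `ρ`. -/
def refineFilling (h : lam.colLen 0 ≤ k + 1) (B : Filling lam (OddLetter k))
    (ν ρ : Fin (k + 1) → ℕ) : Filling lam (OSPLetter (k + 1) 1) := fun c =>
  (ofLex (B c)).elim small fun _ =>
    if c.1.2 < ν (cellRow h c) then top else if c.1.2 < ρ (cellRow h c) then topBar else prime

section Refine

variable {h : lam.colLen 0 ≤ k + 1} {B : Filling lam (OddLetter k)} {ν ρ : Fin (k + 1) → ℕ}
  {c : lam.cells}

theorem refineFilling_of_symp {b : SympLetter k} (hb : B c = OddLetter.symp b) :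
    refineFilling h B ν ρ c = small b := by
  simp only [refineFilling, hb]
  rfl

theorem refineFilling_of_last (hb : B c = OddLetter.last) :
    refineFilling h B ν ρ c =
      if c.1.2 < ν (cellRow h c) then top else if c.1.2 < ρ (cellRow h c) then topBar else prime := by
  simp only [refineFilling, hb]
  rfl

theorem collapseFilling_refineFilling : collapseFilling (refineFilling h B ν ρ) = B := by
  funext c
  rcases (B c).cases with ⟨b, hb⟩ | hb
  · rw [collapseFilling, refineFilling_of_symp hb, collapse_small, hb]
  · rw [collapseFilling, hb, collapse_eq_last_iff, refineFilling_of_last hb]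
    split_ifs
    · exact le_rfl
    · exact top_lt_topBar.le
    · exact (top_lt_topBar.trans topBar_lt_prime).le

theorem isRowProfile_refineFilling_top {μ : Fin (k + 1) → ℕ}
    (hμ : IsRowProfile h (fun c => B c ≠ OddLetter.last) μ) (hμν : μ ≤ ν)
    (hν : ν ≤ rowLens k lam) : IsRowProfile h (fun c => refineFilling h B ν ρ c ≤ top) ν := by
  refine ⟨hν, fun c => ?_⟩
  rcases (B c).cases with ⟨b, hb⟩ | hb
  · refine iff_of_true ?_ (((hμ.iff c).1 ?_).trans_le (hμν _))
    · rw [refineFilling_of_symp hb]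
      exact (small_lt_top b).le
    · rw [hb]
      exact OddLetter.symp_ne_last b
  · rw [refineFilling_of_last hb]
    split_ifs with h1 h2
    · exact iff_of_true le_rfl h1
    · exact iff_of_false (not_le.2 top_lt_topBar) h1
    · exact iff_of_false (not_le.2 (top_lt_topBar.trans topBar_lt_prime)) h1

theorem isRowProfile_refineFilling_topBar {μ : Fin (k + 1) → ℕ}
    (hμ : IsRowProfile h (fun c => B c ≠ OddLetter.last) μ) (hμν : μ ≤ ν) (hνρ : ν ≤ ρ)
    (hρ : ρ ≤ rowLens k lam) : IsRowProfile h (fun c => refineFilling h B ν ρ c ≤ topBar) ρ := by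
  refine ⟨hρ, fun c => ?_⟩
  rcases (B c).cases with ⟨b, hb⟩ | hb
  · refine iff_of_true ?_ (((hμ.iff c).1 ?_).trans_le ((hμν.trans hνρ) _))
    · rw [refineFilling_of_symp hb]
      exact ((small_lt_top b).trans top_lt_topBar).le
    · rw [hb]
      exact OddLetter.symp_ne_last b
  · rw [refineFilling_of_last hb]
    split_ifs with h1 h2
    · exact iff_of_true top_lt_topBar.le (h1.trans_le (hνρ _))
    · exact iff_of_true le_rfl h2
    · exact iff_of_false (not_le.2 topBar_lt_prime) h2

theorem refineFilling_collapseFilling {T : Filling lam (OSPLetter (k + 1) 1)}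
    (hν : IsRowProfile h (fun c => T c ≤ top) ν)
    (hρ : IsRowProfile h (fun c => T c ≤ topBar) ρ) :
    refineFilling h (collapseFilling T) ν ρ = T := by
  funext c
  rcases (T c).small_or_top_le with ⟨b, hb⟩ | hle
  · rw [refineFilling_of_symp (collapse_eq_symp_iff.2 hb), hb]
  · rw [refineFilling_of_last (collapse_of_le hle)]
    simp only [← hν.iff, ← hρ.iff]
    split_ifs with h1 h2
    · exact le_antisymm hle h1
    · exact le_antisymm (not_lt.1 fun h3 => h1 (le_top_of_lt_topBar h3)) h2
    · by_contra h3
      exact h2 (le_topBar_of_ne_prime (Ne.symm h3))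

end Refine

/-! ### Weights and the sum over a fibre -/

/-- The weight of a tableau is the weight of the small letters, which only depends on the collapse,
times a factor given by the sizes of the three strips. -/
theorem ospWeight_eq_of_isRowProfile {R : Type*} [CommRing R] {h : lam.colLen 0 ≤ k + 1}
    {T : Filling lam (OSPLetter (k + 1) 1)} {μ ν ρ : Fin (k + 1) → ℕ}
    (hμ : IsRowProfile h (fun c => T c < top) μ)
    (hν : IsRowProfile h (fun c => T c ≤ top) ν)
    (hρ : IsRowProfile h (fun c => T c ≤ topBar) ρ) (x : Fin k → Rˣ) (z : Rˣ) :
    ospWeight (Fin.snoc (α := fun _ => Rˣ) x z⁻¹) (fun _ : Fin 1 => -((z⁻¹ : Rˣ) : R)) T =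
      ((∏ i, x i ^ (((collapseFilling T).count (OddLetter.symp (SympLetter.plain i)) : ℤ) -
        ((collapseFilling T).count (OddLetter.symp (SympLetter.bar i)) : ℤ)) : Rˣ) : R) *
      (((z⁻¹ : Rˣ) : R) ^ skewSize μ ν * (z : R) ^ skewSize ν ρ *
        (-((z⁻¹ : Rˣ) : R)) ^ skewSize ρ (rowLens k lam)) := by
  have c1 : T.count top = skewSize μ ν := hμ.card_sdiff hν (fun _ => le_of_lt) fun c => by
    rw [not_lt]
    exact le_antisymm_iff
  have c2 : T.count topBar = skewSize ν ρ :=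
    hν.card_sdiff hρ (fun _ hc => hc.trans top_lt_topBar.le) fun c => by
      rw [le_antisymm_iff, not_le]
      refine and_congr_right fun _ => ⟨fun h1 => top_lt_topBar.trans_le h1, fun h1 => ?_⟩
      exact not_lt.1 fun h2 => absurd h1 (not_lt.2 (le_top_of_lt_topBar h2))
  have c3 : T.count prime = skewSize ρ (rowLens k lam) :=
    hρ.card_sdiff isRowProfile_true (fun _ _ => trivial) fun c => by
      rw [true_and, not_le]
      refine ⟨fun h1 => h1 ▸ topBar_lt_prime, fun h1 => ?_⟩
      by_contra h2
      exact absurd h1 (not_lt.2 (le_topBar_of_ne_prime h2))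
  have c4 : ∀ b, (collapseFilling T).count (OddLetter.symp b) = T.count (small b) := fun b =>
    congrArg Finset.card (Finset.filter_congr fun c _ => collapse_eq_symp_iff)
  have c5 : ∀ i : Fin k, T.count (symp (SympLetter.plain i.castSucc)) =
      (collapseFilling T).count (OddLetter.symp (SympLetter.plain i)) :=
    fun i => (c4 (SympLetter.plain i)).symm
  have c6 : ∀ i : Fin k, T.count (symp (SympLetter.bar i.castSucc)) =
      (collapseFilling T).count (OddLetter.symp (SympLetter.bar i)) :=
    fun i => (c4 (SympLetter.bar i)).symm
  rw [ospWeight, Fin.prod_univ_castSucc, Fin.prod_univ_one]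
  simp only [Fin.snoc_castSucc, Fin.snoc_last, c5, c6]
  change ((_ * z⁻¹ ^ ((T.count top : ℤ) - (T.count topBar : ℤ)) : Rˣ) : R) *
    _ ^ T.count prime = _
  have hz : z⁻¹ ^ ((T.count top : ℤ) - (T.count topBar : ℤ)) =
      z⁻¹ ^ T.count top * z ^ T.count topBar := by
    rw [zpow_sub, zpow_natCast, zpow_natCast, inv_pow z (T.count topBar), inv_inv]
  rw [hz, c1, c2, c3]
  push_cast
  ring

open Classical in
/-- The orthosymplectic tableaux with collapse `B` add up to the odd symplectic contribution
of `B`. -/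
theorem sum_ospWeight_fiber {R : Type*} [CommRing R] (h : lam.colLen 0 ≤ k + 1)
    (x : Fin k → Rˣ) (z : Rˣ) (B : Filling lam (OddLetter k)) :
    (∑ T : Filling lam (OSPLetter (k + 1) 1) with
        IsOrthosymplecticTableau T ∧ collapseFilling T = B,
      ospWeight (Fin.snoc (α := fun _ => Rˣ) x z⁻¹) (fun _ : Fin 1 => -((z⁻¹ : Rˣ) : R)) T) =
      if IsOddSymplecticTableau B then oddWeight x (z : R) B else 0 := by
  by_cases hB : IsSymplecticBase B
  swap
  · rw [if_neg fun hT => hB ((isOddSymplecticTableau_iff h).1 hT).1]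
    refine Finset.sum_eq_zero fun T hT => ?_
    obtain ⟨-, hTo, rfl⟩ := Finset.mem_filter.1 hT
    exact absurd hTo.isSymplecticBase hB
  set μ := rowProfile k fun c => B c ≠ OddLetter.last
  have hμ : IsRowProfile h (fun c => B c ≠ OddLetter.last) μ := isRowProfile_base h hB
  have hμT : ∀ T : Filling lam (OSPLetter (k + 1) 1), collapseFilling T = B →
      IsRowProfile h (fun c => T c < top) μ := by
    rintro T rfl
    exact ⟨hμ.le, fun c => collapse_ne_last_iff.symm.trans (hμ.iff c)⟩
  have hprof : ∀ (T : Filling lam (OSPLetter (k + 1) 1)) (a : OSPLetter (k + 1) 1),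
      IsOrthosymplecticTableau T →
      IsRowProfile h (fun c => T c ≤ a) (rowProfile k fun c => T c ≤ a) := fun T a hT =>
    isRowProfile_rowProfile h fun c d h1 h2 hd => (hT.row_weak c d h1 h2).trans hd
  let w : R := ((∏ i, x i ^ ((B.count (OddLetter.symp (SympLetter.plain i)) : ℤ) -
      (B.count (OddLetter.symp (SympLetter.bar i)) : ℤ)) : Rˣ) : R)
  have hodd : oddWeight x (z : R) B = w * (z : R) ^ skewSize μ (rowLens k lam) := by
    have : B.count OddLetter.last = skewSize μ (rowLens k lam) :=
      hμ.card_sdiff isRowProfile_true (fun _ _ => trivial) fun c => by simp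
    rw [oddWeight, this, mul_comm]
  rw [hodd, isOddSymplecticTableau_iff h, and_iff_right hB, ← mul_ite_zero,
    ← sum_strip_cancel (rowLens k lam) μ rowLens_antitone hμ.le (z : R) ((z⁻¹ : Rˣ) : R),
    Finset.mul_sum]
  refine Finset.sum_nbij'
    (fun T => (rowProfile k fun c => T c ≤ top, rowProfile k fun c => T c ≤ topBar))
    (fun p => refineFilling h B p.1 p.2) (fun T hT => ?_) (fun p hp => ?_) (fun T hT => ?_)
    (fun p hp => ?_) fun T hT => ?_
  · obtain ⟨-, hT, hTB⟩ := Finset.mem_filter.1 hT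
    have hν := hprof T top hT
    have hρ := hprof T topBar hT
    have hstrips := (isOrthosymplecticTableau_iff hT.isSymplecticBase (hμT T hTB) hν hρ).1 hT
    rw [Finset.mem_filter, Finset.mem_product, Finset.mem_Icc, Finset.mem_Icc]
    exact ⟨⟨⟨hstrips.1.1, hν.le⟩, fun i => (hstrips.1.1 i).trans (hstrips.2.1.1 i), hρ.le⟩, hstrips⟩
  · rw [Finset.mem_filter, Finset.mem_product, Finset.mem_Icc, Finset.mem_Icc] at hp
    obtain ⟨⟨⟨h1, h2⟩, h3, h4⟩, hstrips⟩ := hp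
    refine Finset.mem_filter.2 ⟨Finset.mem_univ _, ?_, collapseFilling_refineFilling⟩
    refine (isOrthosymplecticTableau_iff (by rwa [collapseFilling_refineFilling])
      (hμT _ collapseFilling_refineFilling) (isRowProfile_refineFilling_top hμ h1 h2)
      (isRowProfile_refineFilling_topBar hμ h1 hstrips.2.1.1 h4)).2 hstrips
  · obtain ⟨-, hTo, rfl⟩ := Finset.mem_filter.1 hT
    exact refineFilling_collapseFilling (hprof T top hTo) (hprof T topBar hTo)
  · rw [Finset.mem_filter, Finset.mem_product, Finset.mem_Icc, Finset.mem_Icc] at hp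
    obtain ⟨⟨⟨h1, h2⟩, h3, h4⟩, hstrips⟩ := hp
    have hν := isRowProfile_refineFilling_top (ρ := p.2) hμ h1 h2
    have hρ := isRowProfile_refineFilling_topBar hμ h1 hstrips.2.1.1 h4
    have hT := (isOrthosymplecticTableau_iff (by rwa [collapseFilling_refineFilling])
      (hμT _ collapseFilling_refineFilling) hν hρ).2 hstrips
    exact Prod.ext ((hprof _ top hT).unique hν) ((hprof _ topBar hT).unique hρ)
  · obtain ⟨-, hT, hTB⟩ := Finset.mem_filter.1 hT
    rw [ospWeight_eq_of_isRowProfile (hμT T hTB) (hprof T top hT) (hprof T topBar hT), hTB]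

theorem oddSymplecticCharacter_eq {R : Type*} [CommRing R] (h : lam.colLen 0 ≤ k + 1)
    (x : Fin k → Rˣ) (z : Rˣ) :
    oddSymplecticCharacter lam x (z : R) =
      orthosymplecticSchur lam (Fin.snoc (α := fun _ => Rˣ) x z⁻¹)
        (fun _ : Fin 1 => -((z⁻¹ : Rˣ) : R)) := by
  classical
  rw [oddSymplecticCharacter, orthosymplecticSchur, Finset.sum_filter,
    ← Finset.sum_fiberwise _ collapseFilling]
  refine Finset.sum_congr rfl fun B _ => ?_
  rw [Finset.filter_filter, sum_ospWeight_fiber h x z B]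

end Tableaux

theorem corollary2 {R : Type*} [CommRing R] (n : ℕ) (hn : 1 ≤ n) (lam : YoungDiagram)
    (hlam : lam.colLen 0 ≤ n) (x : Fin (n - 1) → Rˣ) (xn : Rˣ) :
    oddSymplecticCharacter lam x (xn : R) =
      orthosymplecticSchur lam (Fin.snoc (α := fun _ => Rˣ) x xn⁻¹)
        (fun _ : Fin 1 => -((xn⁻¹ : Rˣ) : R)) :=
  oddSymplecticCharacter_eq (by omega) x xn
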